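/- Let $k$ be an algebraically closed field of any characteristic, $\mathcal P=k[X_0,\dots,X_n]$ with the variables ordered by $X_0<X_1<\dots<X_n$, and let $J\subseteq\mathcal P$ be a strongly stable monomial ideal: whenever $X_iX^\delta\in J$ and $i<j$, also $X_jX^\delta\in J$. Let $B_J$ be the minimal monomial basis of $J$, $\mathcal N(J)$ the set of monomials not in $J$, and $J_m$ the degree $m$ component of $J$. For every $X^\alpha\in B_J$ and every $X^\gamma\in\mathcal N(J)$ of the same degree let $C_{\alpha\gamma}$ be a new variable; let $C$ be the set of these variables, $N$ their number, and put $$F_\alpha=X^\alpha-\sum_\gamma C_{\alpha\gamma}X^\gamma\in k[C][X_0,\dots,X_n],\qquad \mathcal G=\{F_\alpha : X^\alpha\in B_J\}.$$ For $c\in k^N$ write $f_{\alpha,c}\in\mathcal P$ for the specialization of $F_\alpha$ at $C=c$. For $m\ge 0$ let $A_m$ be the matrix over $k[C]$ whose columns are indexed by the monomials of degree $m$ in $X$ and whose rows contain the coefficients of the polynomials $X^\beta F_\alpha$ with $|\beta+\alpha|=m$. Let $\mathfrak A\subseteq k[C]$ be the ideal generated by the minors of order $\dim_k J_m+1$ of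 $A_m$, for all $m\ge 0$, and let $B\mathcal St(J)=\operatorname{Spec} k[C]/\mathfrak A\subseteq\mathbb A^N$. The head of $X^\delta F_\alpha$ is $X^{\delta+\alpha}$. Among the products with the same head, set $X^{\delta'}F_{\alpha'}<X^\delta F_\alpha$ if the first non-zero entry of $\delta'-\delta$ is positive (the entries being indexed by $0,\dots,n$ in this order), and call a product minimal if it is the minimum of the set of all products with its head. A step of $\mathcal G^{**}$-reduction of a polynomial $h\in k[C][X]$ replaces $h$ by $h-aX^\delta F_\alpha$, where $X^\delta F_\alpha$ is minimal and $a\neq 0$ is the coefficient in $h$ of its head $X^{\delta+\alpha}$. A complete $\mathcal G^{**}$-reduction of $h$ is the result $h_0$ of a finite sequence of such steps in which no monomial of $h_0$ is a multiple of an element of $B_J$. The $S$-polynomial is $S(F_\alpha,F_{\alpha'})=X^\delta F_\alpha-X^{\delta'}F_{\alpha'}$ with $X^{\delta+\alpha}=X^{\delta'+\alpha'}=\operatorname{lcm}(X^\alpha,X^{\alpha'})$. Then: 1. There is a bijection between the closed points of $B\mathcal St(J)$ and the homogeneous ideals $I\subseteq\mathcal P$ such that $\mathcal N(J)$ is a basis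 of the $k$-vector space $\mathcal P/I$. It sends the closed point with coordinates $c\in k^N$ to the ideal $(f_{\alpha,c} : X^\alpha\in B_J)$. The origin is a closed point of $B\mathcal St(J)$ and corresponds to $J$. 2. $\mathfrak A$ is homogeneous for the grading $\lambda$ of $k[C]$ over $\mathbb Z^{n+1}$ given by $\lambda(C_{\alpha\gamma})=\alpha-\gamma$. 3. Every $S(F_\alpha,F_{\alpha'})$ has a complete $\mathcal G^{**}$-reduction. For any choice of complete $\mathcal G^{**}$-reductions $H_{\alpha,\alpha'}$ of all the $S(F_\alpha,F_{\alpha'})$, let $\mathfrak R\subseteq k[C]$ be the ideal generated by the coefficients (with respect to $X$) of all the $H_{\alpha,\alpha'}$, and $\mathfrak R'$ the ideal generated by the coefficients of those $H_{\alpha,\alpha'}$ for which, in $S(F_\alpha,F_{\alpha'})=X^\delta F_\alpha-X^{\delta'}F_{\alpha'}$, the product $X^\delta F_\alpha$ is minimal. Then $\mathfrak A=\mathfrak R=\mathfrak R'$. -/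

import Mathlib

open MvPolynomial AlgebraicGeometry

noncomputable section

namespace Stratum

universe u

/-- Exponents of monomials in the variables `X_0 < X_1 < ... < X_n`. -/
abbrev Mon (n : ℕ) : Type := Fin (n + 1) →₀ ℕ

/-- The polynomial ring in `X_0, ..., X_n` over `R`. -/
abbrev Poly (n : ℕ) (R : Type u) [CommRing R] : Type u := MvPolynomial (Fin (n + 1)) R

/-- An elementary up move: a variable `X_i` dividing `X^α` is replaced by a larger one `X_j`. -/
def UpMove {n : ℕ} (α β : Mon n) : Prop :=
  ∃ (δ : Mon n) (i j : Fin (n + 1)), i < j ∧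
    α = δ + Finsupp.single i 1 ∧ β = δ + Finsupp.single j 1

/-- `X^α ≺_B X^β`: one passes from `X^α` to `X^β` by a sequence of up moves. -/
def BorelLT {n : ℕ} : Mon n → Mon n → Prop := Relation.TransGen UpMove

section Ideals

variable {n : ℕ} {k : Type u} [Field k]

attribute [local instance] MvPolynomial.gradedAlgebra
attribute [local instance] MvPolynomial.weightedGradedAlgebra

/-- The exponents of the monomials that belong to `J`. -/
def monomialsIn (J : Ideal (Poly n k)) : Set (Mon n) := {α | monomial α (1 : k) ∈ J}

/-- `J` is generated by monomials. -/
def IsMonomialIdeal (J : Ideal (Poly n k)) : Prop :=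
  J = Ideal.span ((fun α : Mon n => monomial α (1 : k)) '' monomialsIn J)

/-- `J` is a strongly stable monomial ideal. -/
def IsStronglyStable (J : Ideal (Poly n k)) : Prop :=
  IsMonomialIdeal J ∧ ∀ α β : Mon n, BorelLT β α → β ∈ monomialsIn J → α ∈ monomialsIn J

/-- The monomial basis `B_J`: the monomials of `J` that are minimal for divisibility. -/
def basisMon (J : Ideal (Poly n k)) : Set (Mon n) :=
  {α | α ∈ monomialsIn J ∧ ∀ β ∈ monomialsIn J, β ≤ α → β = α}

/-- The sous-escalier `N(J)`. -/
def sousEscalier (J : Ideal (Poly n k)) : Set (Mon n) := {γ | γ ∉ monomialsIn J}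

/-- The homogeneous component `J_m`, as a vector space. -/
def degreePart (J : Ideal (Poly n k)) (m : ℕ) : Submodule k (Poly n k) :=
  J.restrictScalars k ⊓ homogeneousSubmodule (Fin (n + 1)) k m

/-- The homogeneous ideals `I` such that `N(J)` is a basis of the vector space `P/I`. -/
def family (J : Ideal (Poly n k)) : Set (Ideal (Poly n k)) :=
  {I | I.IsHomogeneous (homogeneousSubmodule (Fin (n + 1)) k) ∧
    LinearIndependent k
      (fun γ : sousEscalier J => Ideal.Quotient.mk I (monomial (γ : Mon n) (1 : k))) ∧
    Submodule.span k (Set.range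
      (fun γ : sousEscalier J => Ideal.Quotient.mk I (monomial (γ : Mon n) (1 : k)))) = ⊤}

/-- The index set of the variables `C_{αγ}`: pairs `(α, γ)` with `X^α ∈ B_J`, `X^γ ∈ N(J)` and
`|γ| = |α|`. -/
def Var (J : Ideal (Poly n k)) : Type :=
  {p : Mon n × Mon n // p.1 ∈ basisMon J ∧ p.2 ∈ sousEscalier J ∧ p.2.degree = p.1.degree}

open Classical in
/-- The marked polynomial `f_α = X^α - ∑ c_{αγ} X^γ`, the sum being over `X^γ ∈ N(J)` with
`|γ| = |α|`, with coefficients `c` in any commutative ring. -/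
def marked (J : Ideal (Poly n k)) {R : Type u} [CommRing R] (c : Var J → R) (α : basisMon J) :
    Poly n R :=
  monomial (α : Mon n) 1 -
    ∑ γ ∈ Finset.univ.finsuppAntidiag (α : Mon n).degree,
      if h : γ ∈ sousEscalier J ∧ γ.degree = (α : Mon n).degree then
        monomial γ (c ⟨(α, γ), α.2, h⟩)
      else 0

/-- Indices `(δ, α)` of the products `X^δ f_α`, `X^α ∈ B_J`. -/
abbrev Mult (J : Ideal (Poly n k)) : Type := Mon n × basisMon J

/-- The head `X^{δ+α}` of `X^δ f_α`. -/
def head {J : Ideal (Poly n k)} (p : Mult J) : Mon n := p.1 + p.2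

/-- The product `X^δ f_α`. -/
def multPoly {J : Ideal (Poly n k)} {R : Type u} [CommRing R] (c : Var J → R) (p : Mult J) :
    Poly n R :=
  monomial p.1 1 * marked J c p.2

/-- `X^{δ'} f_{α'} < X^δ f_α` if the first non-zero entry of `δ' - δ` is positive. -/
def MultLT {J : Ideal (Poly n k)} (p' p : Mult J) : Prop :=
  ∃ i, p.1 i < p'.1 i ∧ ∀ j < i, p'.1 j = p.1 j

/-- `X^δ f_α` is the minimum of the set of those `X^{δ'} f_{α'}` that have the same head. -/
def IsMin {J : Ideal (Poly n k)} (p : Mult J) : Prop :=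
  ∀ q : Mult J, head q = head p → q ≠ p → MultLT p q

/-- One step of `G**`-reduction: a monomial that appears in `h` and is the head of a minimal
`X^δ f_α` is rewritten by means of `X^δ f_α`. -/
def Step {J : Ideal (Poly n k)} {R : Type u} [CommRing R] (c : Var J → R) (h h' : Poly n R) :
    Prop :=
  ∃ p : Mult J, IsMin p ∧ head p ∈ h.support ∧
    h' = h - MvPolynomial.C (coeff (head p) h) * multPoly c p

/-- `h₀` is obtained from `h` by a complete `G**`-reduction: finitely many steps, and no monomial
of `h₀` is a multiple of an element of `B_J`. -/
def IsCompleteReduction {J : Ideal (Poly n k)} {R : Type u} [CommRing R] (c : Var J → R)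
    (h h₀ : Poly n R) : Prop :=
  Relation.ReflTransGen (Step c) h h₀ ∧ ∀ η ∈ h₀.support, ∀ α ∈ basisMon J, ¬ α ≤ η

/-- The index of the multiple of `f_α` with head `lcm(X^α, X^{α'})`. -/
def lcmMult {J : Ideal (Poly n k)} (α α' : basisMon J) : Mult J :=
  (((α : Mon n) ⊔ (α' : Mon n)) - α, α)

/-- The `S`-polynomial of `f_α` and `f_{α'}`. -/
def sPoly {J : Ideal (Poly n k)} {R : Type u} [CommRing R] (c : Var J → R)
    (α α' : basisMon J) : Poly n R :=
  multPoly c (lcmMult α α') - multPoly c (lcmMult α' α)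

/-- The ring `k[C]`. -/
abbrev CoeffRing (J : Ideal (Poly n k)) : Type u := MvPolynomial (Var J) k

/-- The coefficients of the generic marked set: `C_{αγ}` itself. -/
def generic (J : Ideal (Poly n k)) : Var J → CoeffRing J := MvPolynomial.X

/-- The matrix `A_m`: rows `X^β F_α` with `|β + α| = m`, columns the monomials of degree `m`. -/
def coeffMatrix (J : Ideal (Poly n k)) (m : ℕ) :
    Matrix {p : Mult J // (head p).degree = m} {δ : Mon n // δ.degree = m} (CoeffRing J) :=
  Matrix.of fun p δ => coeff (δ : Mon n) (multPoly (generic J) (p : Mult J))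

/-- The ideal `𝔄` of the minors of order `dim J_m + 1` of `A_m`, for all `m`. -/
def idealA (J : Ideal (Poly n k)) : Ideal (CoeffRing J) :=
  Ideal.span {d | ∃ (m : ℕ)
    (f : Fin (Module.finrank k (degreePart J m) + 1) ↪ {p : Mult J // (head p).degree = m})
    (g : Fin (Module.finrank k (degreePart J m) + 1) ↪ {δ : Mon n // δ.degree = m}),
    d = ((coeffMatrix J m).submatrix f g).det}

/-- The ideal generated by the coefficients of the polynomials `H_{αα'}`. -/
def idealR {J : Ideal (Poly n k)} (H : basisMon J → basisMon J → Poly n (CoeffRing J)) :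
    Ideal (CoeffRing J) :=
  Ideal.span {d | ∃ (α α' : basisMon J) (γ : Mon n), d = coeff γ (H α α')}

/-- The same, using only the `S`-polynomials `X^δ F_α - X^{δ'} F_{α'}` such that `X^δ F_α` is
minimal among those with its head. -/
def idealR' {J : Ideal (Poly n k)} (H : basisMon J → basisMon J → Poly n (CoeffRing J)) :
    Ideal (CoeffRing J) :=
  Ideal.span {d | ∃ (α α' : basisMon J) (γ : Mon n),
    IsMin (lcmMult α α') ∧ d = coeff γ (H α α')}

/-- The grading of `k[C]` over `ℤ^{n+1}`: `λ(C_{αγ}) = α - γ`. -/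
def lam (J : Ideal (Poly n k)) (v : Var J) : Fin (n + 1) → ℤ :=
  fun i => (v.1.1 i : ℤ) - (v.1.2 i : ℤ)

/-- Homogeneity of an ideal of `k[C]` for the grading `lam`. -/
def IsLamHomogeneous {J : Ideal (Poly n k)} (I : Ideal (CoeffRing J)) : Prop :=
  I.IsHomogeneous (weightedHomogeneousSubmodule k (lam J))

/-- The affine space `𝔸^N = Spec k[C]`. -/
def affineN (J : Ideal (Poly n k)) : Scheme.{u} := Spec (CommRingCat.of (CoeffRing J))

/-- The stratum of `J` as the scheme `Spec k[C]/𝔄`. -/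
def BSt (J : Ideal (Poly n k)) : Scheme.{u} :=
  Spec (CommRingCat.of (CoeffRing J ⧸ idealA J))

/-- The closed immersion of the stratum in `𝔸^N`. -/
def BSt.ι (J : Ideal (Poly n k)) : BSt J ⟶ affineN J :=
  Spec.map (CommRingCat.ofHom (Ideal.Quotient.mk (idealA J)))

/-- The prime ideal of `k[C]` of a point of the stratum, viewed as a point of `𝔸^N`. -/
def pointIdeal {J : Ideal (Poly n k)} (x : BSt J) : Ideal (CoeffRing J) :=
  PrimeSpectrum.asIdeal (R := CoeffRing J) ((BSt.ι J) x)

/-- The maximal ideal of `k[C]` of the point of `𝔸^N` with coordinates `c ∈ k^N`. -/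
def coordIdeal {J : Ideal (Poly n k)} (c : Var J → k) : Ideal (CoeffRing J) :=
  RingHom.ker (MvPolynomial.eval c)

end Ideals

end Stratum

end

noncomputable section

namespace Stratum

universe u

variable {n : ℕ} {k : Type u} [Field k] {J : Ideal (Poly n k)}

/-! Each monomial of a strongly stable J factors as X^δ X^α with X^α ∈ B_J and no variable of X^δ
larger than one of X^α (`exists_isStar`). These star products are the minimal products. Reducing by
X^δ F_α creates monomials X^δ X^γ with X^γ ∈ N(J), and those still in J have a star cofactor smaller
than δ in the colexicographic order (`minExp_lt`). This well-order plays the role of a term order: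
reduction terminates, and the minimal products are triangular. So over any coefficient ring the
polynomials are the direct sum of the span of the minimal products and the span of N(J)
(`exists_isCompleteReduction`, `eq_zero_of_mem_minSpan`).

For a ring map φ : k[C] → S let V(φ) say that, after applying φ, every product X^δ F_α lies in the
S-span of the minimal ones. In degree m there are dim J_m minimal products, and their coefficients
at the monomials of J form an invertible matrix; hence V(φ) holds iff φ kills 𝔄
(`idealA_le_ker_iff`). Under V(φ) all reduced S-polynomials die (`map_reduction_eq_zero`). If those
defining ℜ' die, V(φ) follows (`multPoly_mem_minSpan_of_reductions`). The quotient maps by 𝔄 and by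
ℜ' then give 𝔄 ⊆ ℜ' ⊆ ℜ ⊆ 𝔄.

For φ the evaluation at c, V(φ) makes the span of the minimal products equal to the ideal of the
f_{α,c}, so N(J) is a basis of the quotient; conversely each ideal of the family arises from exactly
one such c. The Nullstellensatz turns these c into closed points. Homogeneity of 𝔄 holds because
each entry of A_m has weight head minus column. -/

theorem monomialsIn_mono {μ ν : Mon n} (h : μ ≤ ν) (hμ : μ ∈ monomialsIn J) :
    ν ∈ monomialsIn J := by
  obtain ⟨δ, rfl⟩ := exists_add_of_le h
  have := J.mul_mem_right (monomial δ (1 : k)) hμ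
  rwa [monomial_mul, one_mul] at this

theorem exists_basisMon_le {μ : Mon n} (hμ : μ ∈ monomialsIn J) : ∃ α ∈ basisMon J, α ≤ μ := by
  obtain ⟨α, hαμ, hα⟩ := exists_minimal_le_of_wellFoundedLT (· ∈ monomialsIn J) μ hμ
  exact ⟨α, ⟨hα.1, fun β hβ h => le_antisymm h (hα.2 hβ h)⟩, hαμ⟩

theorem head_mem_monomialsIn (p : Mult J) : head p ∈ monomialsIn J :=
  monomialsIn_mono le_add_self p.2.2.1

theorem mult_ext {p q : Mult J} (hh : head p = head q) (h : p.1 = q.1) : p = q := by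
  refine Prod.ext h (Subtype.ext ?_)
  unfold head at hh
  rw [h] at hh
  exact add_left_cancel hh

theorem MultLT.asymm {p q : Mult J} (h : MultLT p q) : ¬ MultLT q p := by
  rintro ⟨j, hj, hj'⟩
  obtain ⟨i, hi, hi'⟩ := h
  rcases lt_trichotomy i j with hij | rfl | hij
  · have := hj' i hij; omega
  · omega
  · have := hi' j hij; omega

theorem IsMin.unique {p q : Mult J} (hp : IsMin p) (hq : IsMin q) (h : head p = head q) :
    p = q := by
  by_contra hpq
  exact (hp q h.symm (Ne.symm hpq)).asymm (hq p h hpq)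

/-! ### Star decompositions and minimal products -/

/-- The variables of the cofactor are not larger than those of the basis monomial. -/
def IsStar (p : Mult J) : Prop := ∀ i j, p.1 i ≠ 0 → (p.2 : Mon n) j ≠ 0 → i ≤ j

/-- If `X^ε X^β = X^δ X^μ` and `X^ε X^β` is a star product, then `X^ε` is smaller than `X^δ` for
the lexicographic order in which the last variable is the largest, unless `X^β` divides `X^μ`. -/
theorem IsStar.toColex_lt {p : Mult J} (hp : IsStar p) {δ μ : Mon n} (h : head p = δ + μ)
    (hμ : ¬ (p.2 : Mon n) ≤ μ) : toColex p.1 < toColex δ := by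
  have hc : ∀ i, p.1 i + (p.2 : Mon n) i = δ i + μ i := fun i => DFunLike.congr_fun h i
  by_contra hlt
  rcases eq_or_lt_of_le (not_lt.mp hlt) with he | hlt
  · apply hμ
    have : δ = p.1 := he
    intro i
    have := hc i
    subst δ
    omega
  -- At the last index i where δ and the star cofactor differ, the latter is larger. Then X^β agrees
  -- with X^μ above i, has smaller exponent at i, and by the star condition involves no variable
  -- below i; so it would divide X^μ.
  · obtain ⟨i, hi, hi'⟩ := Finsupp.Colex.lt_iff.mp hlt
    simp only [ofColex_toColex] at hi hi'
    apply hμ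
    intro j
    have h1 := hc j
    rcases lt_trichotomy i j with hij | rfl | hij
    · have := hi j hij; omega
    · omega
    · have : (p.2 : Mon n) j = 0 := by
        by_contra h0
        exact absurd (hp i j (by omega) h0) (not_le.mpr hij)
      omega

/-- If the first differing exponent favoured a competitor q, the basis monomial of p would contain
that variable, so by the star condition the cofactor of p would involve no later one. The basis
monomial of q would then divide that of p properly, against minimality in B_J. -/
theorem IsStar.isMin {p : Mult J} (hp : IsStar p) : IsMin p := by
  intro q hq hqp
  have hc : ∀ i, q.1 i + (q.2 : Mon n) i = p.1 i + (p.2 : Mon n) i :=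
    fun i => DFunLike.congr_fun hq i
  have hne : q.1 ≠ p.1 := fun h => hqp (mult_ext hq h)
  rcases lt_or_gt_of_ne (show toLex q.1 ≠ toLex p.1 from hne) with hlt | hlt
  · obtain ⟨i, hi, hi'⟩ := Finsupp.Lex.lt_iff.mp hlt
    exact ⟨i, hi', fun j hj => (hi j hj).symm⟩
  · exfalso
    obtain ⟨i, hi, hi'⟩ := Finsupp.Lex.lt_iff.mp hlt
    simp only [ofLex_toLex] at hi hi'
    have hle : (q.2 : Mon n) ≤ (p.2 : Mon n) := by
      intro j
      have h1 := hc j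
      rcases lt_trichotomy i j with hij | rfl | hij
      · have : p.1 j = 0 := by
          by_contra h0
          have h2 := hc i
          exact absurd (hp j i h0 (by omega)) (not_le.mpr hij)
        omega
      · omega
      · have := hi j hij; omega
    have := DFunLike.congr_fun (p.2.2.2 _ q.2.2.1 hle) i
    have := hc i
    omega

theorem exists_isStar (hJ : IsStronglyStable J) {μ : Mon n} (hμ : μ ∈ monomialsIn J) :
    ∃ p : Mult J, IsStar p ∧ head p = μ := by
  classical
  -- The lexicographically largest cofactor works: maximality forces both the quotient into B_J and
  -- the star condition.
  obtain ⟨δ, hδ, hmax⟩ := Finset.exists_max_image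
    ((Finset.Iic μ).filter fun δ => μ - δ ∈ monomialsIn J) toLex ⟨0, by simpa using hμ⟩
  simp only [Finset.mem_filter, Finset.mem_Iic] at hδ hmax
  obtain ⟨hle, hmem⟩ := hδ
  have hle' : ∀ i, δ i ≤ μ i := hle
  have hbas : μ - δ ∈ basisMon J := by
    refine ⟨hmem, fun β hβ hβle => ?_⟩
    have hβle' : ∀ i, β i ≤ μ i - δ i := fun i => by simpa using hβle i
    have h1 : μ - (μ - β) = β := by ext i; have := hβle' i; simp; omega
    have h2 := hmax (μ - β) ⟨tsub_le_self, by rwa [h1]⟩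
    have h3 : δ ≤ μ - β := by
      intro i; have := hβle' i; have := hle' i; simp; omega
    have h4 : μ - β = δ := toLex.injective (le_antisymm h2 (Finsupp.toLex_monotone h3))
    rw [← h4, h1]
  refine ⟨(δ, ⟨μ - δ, hbas⟩), ?_, add_tsub_cancel_of_le hle⟩
  intro i j hi hj
  simp only [Finsupp.coe_tsub, Pi.sub_apply] at hi hj
  by_contra hij
  rw [not_le] at hij
  have hi' := hle' i
  have hj' := hle' j
  -- Exchanging X_i in the cofactor for the smaller X_j makes an up move in the quotient, which
  -- stays in J by strong stability, while the cofactor grows lexicographically.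
  set δ' : Mon n := δ - Finsupp.single i 1 + Finsupp.single j 1 with hδ'
  have e1 : μ - δ' = (μ - δ - Finsupp.single j 1) + Finsupp.single i 1 := by
    ext l
    have := hle' l
    simp only [hδ', Finsupp.coe_tsub, Finsupp.coe_add, Pi.sub_apply, Pi.add_apply,
      Finsupp.single_apply]
    split_ifs <;> subst_vars <;> omega
  have e2 : μ - δ = (μ - δ - Finsupp.single j 1) + Finsupp.single j 1 := by
    ext l
    simp only [Finsupp.coe_tsub, Finsupp.coe_add, Pi.sub_apply, Pi.add_apply, Finsupp.single_apply]
    split_ifs <;> subst_vars <;> omega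
  have hin : μ - δ' ∈ monomialsIn J :=
    hJ.2 _ _ (Relation.TransGen.single ⟨_, j, i, hij, e2, e1⟩) hmem
  have hle2 : δ' ≤ μ := by
    intro l
    have := hle' l
    simp only [hδ', Finsupp.coe_tsub, Finsupp.coe_add, Pi.sub_apply, Pi.add_apply,
      Finsupp.single_apply]
    split_ifs <;> subst_vars <;> omega
  refine absurd (hmax δ' ⟨hle2, hin⟩) (not_le.mpr (Finsupp.Lex.lt_iff.mpr ⟨j, ?_, ?_⟩))
  · intro l hl
    simp [hδ', hl.ne', (hl.trans hij).ne']
  · simp [hδ', hij.ne']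

open Classical in
/-- The cofactor of the minimal product with head `X^μ`, when there is one. -/
def minExp (J : Ideal (Poly n k)) (μ : Mon n) : Colex (Mon n) :=
  -- The default 0 concerns only monomials outside J when J is strongly stable.
  if h : ∃ p : Mult J, IsMin p ∧ head p = μ then toColex h.choose.1 else 0

theorem IsMin.minExp_head {p : Mult J} (hp : IsMin p) : minExp J (head p) = toColex p.1 := by
  have h : ∃ q : Mult J, IsMin q ∧ head q = head p := ⟨p, hp, rfl⟩
  rw [minExp, dif_pos h, h.choose_spec.1.unique hp h.choose_spec.2]

/-- The descent behind termination and triangularity: no basis monomial divides X^γ, so the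
comparison of star cofactors is strict. -/
theorem minExp_lt (hJ : IsStronglyStable J) {δ γ : Mon n} (hγ : γ ∈ sousEscalier J)
    (h : δ + γ ∈ monomialsIn J) : minExp J (δ + γ) < toColex δ := by
  obtain ⟨p, hp, hpe⟩ := exists_isStar hJ h
  rw [← hpe, hp.isMin.minExp_head]
  exact hp.toColex_lt hpe fun hle => hγ (monomialsIn_mono hle p.2.2.1)

theorem finite_basisMon (J : Ideal (Poly n k)) : (basisMon J).Finite := by
  refine WellQuasiOrderedLE.finite_of_isAntichain fun α hα β hβ hne hle => hne ?_
  exact hβ.2 α hα.1 hle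

theorem finite_setOf_degree_eq (m : ℕ) : {γ : Mon n | γ.degree = m}.Finite := by
  refine (Finset.finite_toSet (Finset.univ.finsuppAntidiag m)).subset fun γ hγ => ?_
  simpa [Finset.mem_finsuppAntidiag, Finsupp.degree_eq_sum] using hγ

instance (m : ℕ) : Finite {γ : Mon n // γ.degree = m} := finite_setOf_degree_eq m

instance : Finite (Var J) := by
  have h : (⋃ α ∈ basisMon J, (Prod.mk α) '' {γ : Mon n | γ.degree = α.degree}).Finite :=
    (finite_basisMon J).biUnion fun α _ => (finite_setOf_degree_eq _).image _
  exact (h.subset (t := {p : Mon n × Mon n | p.1 ∈ basisMon J ∧ p.2 ∈ sousEscalier J ∧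
    p.2.degree = p.1.degree}) fun p hp => Set.mem_biUnion hp.1 ⟨p.2, hp.2.2, rfl⟩).to_subtype

/-! ### Coefficients and supports of the products, and change of coefficient ring -/

section Coefficients

variable {R : Type u} [CommRing R] (c : Var J → R)

open Classical in
theorem coeff_marked (α : basisMon J) (μ : Mon n) :
    coeff μ (marked J c α) = (if μ = α then 1 else 0) -
      if h : μ ∈ sousEscalier J ∧ μ.degree = (α : Mon n).degree then c ⟨(α, μ), α.2, h⟩ else 0 := by
  rw [marked, coeff_sub, coeff_monomial, coeff_sum]
  congr 1
  · simp [eq_comm]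
  · rw [Finset.sum_eq_single μ]
    · split_ifs <;> simp
    · intro γ _ hγ
      split_ifs <;> simp [coeff_monomial, hγ]
    · intro hμ
      rw [dif_neg, coeff_zero]
      rintro ⟨-, h⟩
      apply hμ
      simpa [Finset.mem_finsuppAntidiag, Finsupp.degree_eq_sum] using h

theorem coeff_marked_self (α : basisMon J) : coeff (α : Mon n) (marked J c α) = 1 := by
  rw [coeff_marked, if_pos rfl, dif_neg (fun h => h.1 α.2.1), sub_zero]

theorem coeff_marked_var (v : Var J) :
    coeff v.1.2 (marked J c ⟨v.1.1, v.2.1⟩) = - c v := by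
  rw [coeff_marked, if_neg, dif_pos v.2.2, zero_sub]
  · rfl
  · intro h
    exact v.2.2.1 (h ▸ v.2.1.1)

theorem mem_support_marked {α : basisMon J} {μ : Mon n} (hμ : coeff μ (marked J c α) ≠ 0) :
    μ = α ∨ μ ∈ sousEscalier J ∧ μ.degree = (α : Mon n).degree := by
  rw [coeff_marked] at hμ
  by_contra! h
  exact hμ (by rw [if_neg h.1, dif_neg (fun h' => h.2 h'.1 h'.2), sub_zero])

theorem coeff_multPoly_add (p : Mult J) (μ : Mon n) :
    coeff (p.1 + μ) (multPoly c p) = coeff μ (marked J c p.2) := by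
  rw [multPoly, coeff_monomial_mul, one_mul]

theorem coeff_multPoly_head (p : Mult J) : coeff (head p) (multPoly c p) = 1 := by
  rw [head, coeff_multPoly_add, coeff_marked_self]

theorem mem_support_multPoly {p : Mult J} {μ : Mon n} (hμ : coeff μ (multPoly c p) ≠ 0) :
    ∃ γ, μ = p.1 + γ ∧ coeff γ (marked J c p.2) ≠ 0 := by
  by_cases h : p.1 ≤ μ
  · obtain ⟨γ, rfl⟩ := exists_add_of_le h
    exact ⟨γ, rfl, by rwa [coeff_multPoly_add] at hμ⟩
  · rw [multPoly, coeff_monomial_mul', if_neg h] at hμ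
    exact absurd rfl hμ

theorem eq_head_or_of_mem_support_multPoly {p : Mult J} {μ : Mon n}
    (hμ : coeff μ (multPoly c p) ≠ 0) :
    μ = head p ∨ ∃ γ ∈ sousEscalier J, μ = p.1 + γ ∧ γ.degree = (p.2 : Mon n).degree := by
  obtain ⟨γ, rfl, hγ⟩ := mem_support_multPoly c hμ
  rcases mem_support_marked c hγ with rfl | ⟨h1, h2⟩
  · exact Or.inl rfl
  · exact Or.inr ⟨γ, h1, rfl, h2⟩

theorem degree_of_mem_support_multPoly {p : Mult J} {μ : Mon n}
    (hμ : coeff μ (multPoly c p) ≠ 0) : μ.degree = (head p).degree := by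
  rcases eq_head_or_of_mem_support_multPoly c hμ with rfl | ⟨γ, -, rfl, h⟩
  · rfl
  · simp [head, h]

variable {c} in
theorem minExp_lt_of_mem_support_multPoly (hJ : IsStronglyStable J) {p : Mult J} {μ : Mon n}
    (hμ : coeff μ (multPoly c p) ≠ 0) (hne : μ ≠ head p) (hμJ : μ ∈ monomialsIn J) :
    minExp J μ < toColex p.1 := by
  rcases eq_head_or_of_mem_support_multPoly c hμ with rfl | ⟨γ, hγ, rfl, -⟩
  · exact absurd rfl hne
  · exact minExp_lt hJ hγ hμJ

variable {S : Type u} [CommRing S] (φ : R →+* S)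

theorem map_marked (α : basisMon J) : map φ (marked J c α) = marked J (φ ∘ c) α := by
  ext μ
  rw [coeff_map, coeff_marked, coeff_marked, map_sub]
  congr 1
  · split_ifs <;> simp
  · by_cases h : μ ∈ sousEscalier J ∧ μ.degree = (α : Mon n).degree
    · rw [dif_pos h, dif_pos h]; rfl
    · rw [dif_neg h, dif_neg h, map_zero]

theorem map_multPoly (p : Mult J) : map φ (multPoly c p) = multPoly (φ ∘ c) p := by
  simp [multPoly, map_marked]

theorem map_sPoly (α α' : basisMon J) : map φ (sPoly c α α') = sPoly (φ ∘ c) α α' := by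
  simp [sPoly, map_multPoly]

end Coefficients

/-! ### Termination of reduction and uniqueness of normal forms -/

section Reduction

variable {R : Type u} [CommRing R]

/-- The span of the minimal products with head in `P`. -/
def minSpan (c : Var J → R) (P : Set (Mon n)) : Submodule R (Poly n R) :=
  Submodule.span R (multPoly c '' {p : Mult J | IsMin p ∧ head p ∈ P})

/-- The set `P` contains the monomials of every minimal product with head in `P`. -/
def ReductionClosed (c : Var J → R) (P : Set (Mon n)) : Prop :=
  ∀ p : Mult J, IsMin p → head p ∈ P → ∀ μ, coeff μ (multPoly c p) ≠ 0 → μ ∈ P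

variable {c : Var J → R} {P : Set (Mon n)}

theorem minSpan_mono {Q : Set (Mon n)} (h : P ⊆ Q) : minSpan c P ≤ minSpan c Q :=
  Submodule.span_mono (Set.image_mono fun _ hp => ⟨hp.1, h hp.2⟩)

theorem multPoly_mem_minSpan {p : Mult J} (hp : IsMin p) (hP : head p ∈ P) :
    multPoly c p ∈ minSpan c P :=
  Submodule.subset_span ⟨p, ⟨hp, hP⟩, rfl⟩

theorem reductionClosed_univ : ReductionClosed c Set.univ := fun _ _ _ _ _ => trivial

theorem reductionClosed_degree (m : ℕ) : ReductionClosed c {μ | μ.degree = m} :=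
  fun _ _ hP _ hμ => (degree_of_mem_support_multPoly c hμ).trans hP

/-- The bound constrains only monomials of J: those of N(J) are never rewritten and must be allowed
freely. -/
theorem reductionClosed_minExp (hJ : IsStronglyStable J) (b : Colex (Mon n)) :
    ReductionClosed c {μ | μ ∈ monomialsIn J → minExp J μ < b} := by
  intro p hp hP μ hμ hμJ
  have h := hP (head_mem_monomialsIn p)
  by_cases hne : μ = head p
  · rwa [hne]
  · rw [hp.minExp_head] at h
    exact (minExp_lt_of_mem_support_multPoly hJ hμ hne hμJ).trans h

theorem ReductionClosed.step (hP : ReductionClosed c P) {h h' : Poly n R} (hs : Step c h h')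
    (hh : ∀ μ, coeff μ h ≠ 0 → μ ∈ P) :
    (∀ μ, coeff μ h' ≠ 0 → μ ∈ P) ∧ h - h' ∈ minSpan c P := by
  obtain ⟨p, hp, hsupp, rfl⟩ := hs
  have hpP := hh _ (mem_support_iff.mp hsupp)
  refine ⟨fun μ hμ => ?_, ?_⟩
  · by_cases h1 : coeff μ h = 0
    · refine hP p hp hpP μ fun h2 => hμ ?_
      rw [coeff_sub, coeff_C_mul, h1, h2, mul_zero, sub_zero]
    · exact hh μ h1
  · rw [sub_sub_cancel, C_mul']
    exact Submodule.smul_mem _ _ (multPoly_mem_minSpan hp hpP)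

theorem ReductionClosed.reflTransGen (hP : ReductionClosed c P) {h h' : Poly n R}
    (hs : Relation.ReflTransGen (Step c) h h') (hh : ∀ μ, coeff μ h ≠ 0 → μ ∈ P) :
    (∀ μ, coeff μ h' ≠ 0 → μ ∈ P) ∧ h - h' ∈ minSpan c P := by
  induction hs with
  | refl => exact ⟨hh, by rw [sub_self]; exact zero_mem _⟩
  | tail _ hst ih =>
    obtain ⟨h1, h2⟩ := hP.step hst ih.1
    exact ⟨h1, by simpa using add_mem ih.2 h2⟩

open Classical in
/-- The multiset of the cofactors of the minimal products whose heads occur in `h`. -/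
def heads (J : Ideal (Poly n k)) (h : Poly n R) : Multiset (Colex (Mon n)) :=
  (h.support.filter (· ∈ monomialsIn J)).val.map (minExp J)

theorem val_eq_inter_add_sdiff {ι : Type*} [DecidableEq ι] (A B : Finset ι) :
    A.val = (A ∩ B).val + (A \ B).val := by
  rw [← Finset.disjUnion_val _ _ (Finset.disjoint_sdiff_inter A B).symm, Finset.disjUnion_eq_union,
    Finset.union_comm, Finset.sdiff_union_inter]

/-- A step removes one head and introduces only monomials of J with smaller cofactor. Different
heads may share a cofactor, hence multisets and the Dershowitz–Manna order. -/
theorem Step.heads_lt (hJ : IsStronglyStable J) {h h' : Poly n R} (hs : Step c h h') :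
    Multiset.IsDershowitzMannaLT (heads J h') (heads J h) := by
  classical
  obtain ⟨p, hp, hsupp, rfl⟩ := hs
  set h' := h - C (coeff (head p) h) * multPoly c p with hh'
  have hcoeff : ∀ μ, coeff μ h' = coeff μ h - coeff (head p) h * coeff μ (multPoly c p) := by
    intro μ; rw [hh', coeff_sub, coeff_C_mul]
  set A := h.support.filter (· ∈ monomialsIn J) with hA
  set B := h'.support.filter (· ∈ monomialsIn J) with hB
  -- The head disappears because its coefficient in the product is 1.
  have hpA : head p ∈ A \ B := by
    simp [hA, hB, hcoeff, coeff_multPoly_head, mem_support_iff.mp hsupp, head_mem_monomialsIn]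
  refine ⟨(A ∩ B).val.map (minExp J), (B \ A).val.map (minExp J), (A \ B).val.map (minExp J),
    ?_, ?_, ?_, ?_⟩
  · intro h0
    have : minExp J (head p) ∈ (A \ B).val.map (minExp J) := Multiset.mem_map_of_mem _ hpA
    rw [h0] at this
    simp at this
  · rw [heads, ← Multiset.map_add, Finset.inter_comm, ← val_eq_inter_add_sdiff]
  · rw [heads, ← Multiset.map_add, ← val_eq_inter_add_sdiff]
  · intro y hy
    obtain ⟨μ, hμ, rfl⟩ := Multiset.mem_map.mp hy
    refine ⟨_, Multiset.mem_map_of_mem _ hpA, ?_⟩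
    simp only [Finset.mem_val, hA, hB, Finset.mem_sdiff, Finset.mem_filter, mem_support_iff,
      not_and'] at hμ
    obtain ⟨⟨h1, h2⟩, h3⟩ := hμ
    have h3 := not_not.mp (h3 h2)
    rw [hp.minExp_head]
    refine minExp_lt_of_mem_support_multPoly (c := c) hJ (fun h0 => h1 ?_) (fun h0 => ?_) h2
    · rw [hcoeff, h3, h0, mul_zero, sub_zero]
    · rw [h0] at h3
      exact mem_support_iff.mp hsupp h3

variable (c) in
theorem exists_isCompleteReduction (hJ : IsStronglyStable J) (h : Poly n R) :
    ∃ h₀, IsCompleteReduction c h h₀ := by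
  induction h using (InvImage.wf (heads J)
    (Multiset.wellFounded_isDershowitzMannaLT (α := Colex (Mon n)))).induction with
  | h h ih =>
    by_cases hc : ∀ η ∈ h.support, ∀ α ∈ basisMon J, ¬ α ≤ η
    · exact ⟨h, .refl, hc⟩
    · push Not at hc
      obtain ⟨η, hη, α, hα, hle⟩ := hc
      obtain ⟨p, hp, rfl⟩ := exists_isStar hJ (monomialsIn_mono hle hα.1)
      have hst : Step c h (h - C (coeff (head p) h) * multPoly c p) := ⟨p, hp.isMin, hη, rfl⟩
      obtain ⟨h₀, h1, h2⟩ := ih _ (hst.heads_lt hJ)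
      exact ⟨h₀, .head hst h1, h2⟩

theorem IsCompleteReduction.mem_sousEscalier {h h₀ : Poly n R} (hc : IsCompleteReduction c h h₀)
    {μ : Mon n} (hμ : coeff μ h₀ ≠ 0) : μ ∈ sousEscalier J := by
  intro hJ
  obtain ⟨α, hα, hle⟩ := exists_basisMon_le hJ
  exact hc.2 μ (mem_support_iff.mpr hμ) α hα hle

theorem ReductionClosed.exists_sub_mem_minSpan (hJ : IsStronglyStable J) (hP : ReductionClosed c P)
    {h : Poly n R} (hh : ∀ μ, coeff μ h ≠ 0 → μ ∈ P) :
    ∃ w : Poly n R, h - w ∈ minSpan c P ∧ ∀ μ, coeff μ w ≠ 0 → μ ∈ P ∧ μ ∈ sousEscalier J := by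
  obtain ⟨w, hw⟩ := exists_isCompleteReduction c hJ h
  obtain ⟨h1, h2⟩ := hP.reflTransGen hw.1 hh
  exact ⟨w, h2, fun μ hμ => ⟨h1 μ hμ, hw.mem_sousEscalier hμ⟩⟩

/-- In a nontrivial combination, a head whose cofactor is colexicographically largest cannot cancel:
any other product containing it would have a larger cofactor. So a monomial of J survives. -/
theorem eq_zero_of_mem_minSpan (hJ : IsStronglyStable J) {w : Poly n R} (hw : w ∈ minSpan c P)
    (hN : ∀ μ, coeff μ w ≠ 0 → μ ∈ sousEscalier J) : w = 0 := by
  obtain ⟨l, hl, rfl⟩ := (Finsupp.mem_span_image_iff_linearCombination R).mp hw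
  by_cases h0 : l.support = ∅
  · rw [Finsupp.support_eq_empty.mp h0, map_zero]
  exfalso
  obtain ⟨p, hpl, hmax⟩ := Finset.exists_max_image l.support (fun p => toColex p.1)
    (Finset.nonempty_iff_ne_empty.mpr h0)
  have hmin : ∀ q ∈ l.support, IsMin q := fun q hq => (hl hq).1
  refine hN (head p) ?_ (head_mem_monomialsIn p)
  rw [Finsupp.linearCombination_apply, Finsupp.sum, coeff_sum, Finset.sum_eq_single p]
  · rw [coeff_smul, coeff_multPoly_head, smul_eq_mul, mul_one]
    exact Finsupp.mem_support_iff.mp hpl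
  · intro q hq hqp
    rw [coeff_smul, smul_eq_mul]
    by_contra h1
    have h2 := minExp_lt_of_mem_support_multPoly hJ (right_ne_zero_of_mul h1)
      (fun h => hqp ((hmin q hq).unique (hmin p hpl) h.symm)) (head_mem_monomialsIn p)
    rw [(hmin p hpl).minExp_head] at h2
    exact absurd (hmax q hq) (not_le.mpr h2)
  · exact fun h => absurd hpl h

/-- Reduction inside `P` leaves a remainder that lies in the span of the minimal products and is
supported on N(J), hence is zero. This localizes membership to a single degree. -/
theorem ReductionClosed.mem_minSpan (hJ : IsStronglyStable J) (hP : ReductionClosed c P)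
    {h : Poly n R} (hh : ∀ μ, coeff μ h ≠ 0 → μ ∈ P) {Q : Set (Mon n)} (hQ : h ∈ minSpan c Q) :
    h ∈ minSpan c P := by
  obtain ⟨w, hw, hwN⟩ := hP.exists_sub_mem_minSpan hJ hh
  have h0 : w = 0 := by
    refine eq_zero_of_mem_minSpan (c := c) (P := Set.univ) hJ ?_ fun μ hμ => (hwN μ hμ).2
    have := sub_mem (minSpan_mono (Set.subset_univ Q) hQ) (minSpan_mono (Set.subset_univ P) hw)
    rwa [sub_sub_cancel] at this
  rwa [h0, sub_zero] at hw

theorem multPoly_mem_minSpan_degree (hJ : IsStronglyStable J) {p : Mult J}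
    (hp : multPoly c p ∈ minSpan c Set.univ) :
    multPoly c p ∈ minSpan c {μ | μ.degree = (head p).degree} :=
  (reductionClosed_degree _).mem_minSpan hJ
    (fun _ hμ => degree_of_mem_support_multPoly c hμ) hp

theorem map_mem_minSpan {S : Type u} [CommRing S] (φ : R →+* S) {h : Poly n R}
    (hh : h ∈ minSpan c P) : map φ h ∈ minSpan (φ ∘ c) P := by
  induction hh using Submodule.span_induction with
  | mem x hx =>
    obtain ⟨p, hp, rfl⟩ := hx
    rw [map_multPoly]
    exact multPoly_mem_minSpan hp.1 hp.2
  | zero => rw [map_zero]; exact zero_mem _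
  | add x y _ _ hx hy => rw [map_add]; exact add_mem hx hy
  | smul a x _ hx =>
    rw [smul_eq_C_mul, map_mul, map_C, ← smul_eq_C_mul]
    exact Submodule.smul_mem _ _ hx

end Reduction

/-! ### S-polynomials as a criterion for reducing every product -/

section SPolynomials

variable {R S : Type u} [CommRing R] [CommRing S] {c : Var J → R} (φ : R →+* S)

/-- Steps need not survive `φ`, since leading coefficients may vanish. Only the resulting congruence
modulo minimal products and the support of the remainder are transported. -/
theorem map_reduction_eq_zero (hJ : IsStronglyStable J)
    (hV : ∀ p : Mult J, multPoly (φ ∘ c) p ∈ minSpan (φ ∘ c) Set.univ) {α α' : basisMon J}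
    {h : Poly n R} (hh : IsCompleteReduction c (sPoly c α α') h) : map φ h = 0 := by
  have h1 := map_mem_minSpan φ
    (reductionClosed_univ.reflTransGen hh.1 fun _ _ => trivial).2
  rw [map_sub, map_sPoly] at h1
  refine eq_zero_of_mem_minSpan (c := φ ∘ c) (P := Set.univ) hJ ?_ fun μ hμ => ?_
  · have := sub_mem (sub_mem (hV (lcmMult α α')) (hV (lcmMult α' α))) h1
    rwa [← sPoly, sub_sub_cancel] at this
  · rw [coeff_map] at hμ
    exact hh.mem_sousEscalier fun h0 => hμ (by rw [h0, map_zero])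

/-- The product of F_α by one variable violating the star condition differs from the minimal product
with the same head by exactly an S-polynomial, one of those used in ℜ'. Its reduction uses only
cofactors below that variable. -/
theorem multPoly_single_mem_span (hJ : IsStronglyStable J)
    (hH : ∀ α α' : basisMon J, IsMin (lcmMult α α') →
      ∃ h, IsCompleteReduction c (sPoly c α α') h ∧ map φ h = 0)
    (α : basisMon J) {i j : Fin (n + 1)} (hj : (α : Mon n) j ≠ 0) (hij : j < i) :
    multPoly (φ ∘ c) (Finsupp.single i 1, α) ∈
      Submodule.span S (multPoly (φ ∘ c) '' {p : Mult J |
        toColex p.1 < toColex (Finsupp.single i 1)}) := by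
  obtain ⟨⟨δ', α'⟩, hstar, hhead⟩ := exists_isStar hJ
    (head_mem_monomialsIn (J := J) (Finsupp.single i 1, α))
  have hc : ∀ l, δ' l + (α' : Mon n) l = Finsupp.single i 1 l + (α : Mon n) l :=
    fun l => DFunLike.congr_fun hhead l
  have hnle : ¬ (α' : Mon n) ≤ α := by
    intro hle
    have heq : (α' : Mon n) = α := α.2.2 _ α'.2.1 hle
    refine absurd (hstar i j ?_ ?_) (not_le.mpr hij)
    · have := hc i
      simp only [heq, Finsupp.single_eq_same] at this
      change δ' i ≠ 0
      omega
    · change (α' : Mon n) j ≠ 0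
      rwa [heq]
  have hlt : toColex δ' < toColex (Finsupp.single i 1) := hstar.toColex_lt hhead hnle
  -- Since X^{α'} divides X_i X^α but not X^α, it takes the full power of X_i; hence X_i X^α is the
  -- lcm.
  have hαi : (α' : Mon n) i = (α : Mon n) i + 1 := by
    by_contra hne
    refine hnle fun l => ?_
    have h1 := hc l
    by_cases hl : l = i
    · subst hl
      simp only [Finsupp.single_eq_same] at h1
      omega
    · rw [Finsupp.single_eq_of_ne hl] at h1
      omega
  have hle : ∀ l, l ≠ i → (α' : Mon n) l ≤ (α : Mon n) l := by
    intro l hl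
    have h1 := hc l
    rw [Finsupp.single_eq_of_ne hl] at h1
    omega
  have hl1 : lcmMult α α' = (Finsupp.single i 1, α) := by
    refine Prod.ext ?_ rfl
    ext l
    simp only [lcmMult, Finsupp.coe_tsub, Finsupp.sup_apply, Pi.sub_apply]
    by_cases hl : l = i
    · subst hl; simp [hαi]
    · rw [Finsupp.single_eq_of_ne hl, sup_eq_left.mpr (hle l hl), Nat.sub_self]
  have hl2 : lcmMult α' α = (δ', α') := by
    refine Prod.ext ?_ rfl
    ext l
    simp only [lcmMult, Finsupp.coe_tsub, Finsupp.sup_apply, Pi.sub_apply]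
    have h1 := hc l
    by_cases hl : l = i
    · subst hl
      simp only [Finsupp.single_eq_same] at h1
      rw [hαi, sup_eq_left.mpr (Nat.le_succ _)]
      omega
    · rw [Finsupp.single_eq_of_ne hl] at h1
      rw [sup_eq_right.mpr (hle l hl)]
      omega
  obtain ⟨h, hred, hφ⟩ := hH α' α (by rw [hl2]; exact hstar.isMin)
  set b := toColex (Finsupp.single i 1 : Mon n) with hb
  -- The common head cancels, so every remaining monomial of J has cofactor below one of the two
  -- cofactors, and thus below `b`.
  have hsupp : ∀ μ, coeff μ (sPoly c α' α) ≠ 0 →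
      μ ∈ {μ | μ ∈ monomialsIn J → minExp J μ < b} := by
    intro μ hμ hμJ
    rw [sPoly, hl1, hl2, coeff_sub] at hμ
    by_cases hne : μ = head ((δ', α') : Mult J)
    · refine absurd ?_ hμ
      rw [hne, coeff_multPoly_head, hhead, coeff_multPoly_head, sub_self]
    · by_cases h1 : coeff μ (multPoly c ((δ', α') : Mult J)) = 0
      · rw [h1, zero_sub, neg_ne_zero] at hμ
        exact minExp_lt_of_mem_support_multPoly hJ hμ (hhead ▸ hne) hμJ
      · exact (minExp_lt_of_mem_support_multPoly hJ h1 hne hμJ).trans hlt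
  have hmem := map_mem_minSpan φ ((reductionClosed_minExp hJ b).reflTransGen hred.1 hsupp).2
  rw [map_sub, hφ, sub_zero, map_sPoly, sPoly, hl1, hl2] at hmem
  have hle : minSpan (φ ∘ c) {μ | μ ∈ monomialsIn J → minExp J μ < b} ≤
      Submodule.span S (multPoly (φ ∘ c) '' {p : Mult J | toColex p.1 < b}) := by
    refine Submodule.span_mono (Set.image_mono fun p hp => ?_)
    have := hp.2 (head_mem_monomialsIn p)
    rwa [hp.1.minExp_head] at this
  have h2 : multPoly (φ ∘ c) ((δ', α') : Mult J) ∈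
      Submodule.span S (multPoly (φ ∘ c) '' {p : Mult J | toColex p.1 < b}) :=
    Submodule.subset_span ⟨_, hlt, rfl⟩
  simpa using sub_mem h2 (hle hmem)

/-- Colexicographic induction on the cofactor: a product that is not star has an offending variable
to split off; rewriting that one-variable product and multiplying back leaves smaller cofactors. -/
theorem multPoly_mem_minSpan_of_reductions (hJ : IsStronglyStable J)
    (hH : ∀ α α' : basisMon J, IsMin (lcmMult α α') →
      ∃ h, IsCompleteReduction c (sPoly c α α') h ∧ map φ h = 0) (p : Mult J) :
    multPoly (φ ∘ c) p ∈ minSpan (φ ∘ c) Set.univ := by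
  obtain ⟨δ, α⟩ := p
  induction hδ : toColex δ using WellFoundedLT.induction generalizing δ α with
  | ind d ih =>
    subst hδ
    by_cases hs : IsStar ((δ, α) : Mult J)
    · exact multPoly_mem_minSpan hs.isMin trivial
    unfold IsStar at hs
    push Not at hs
    obtain ⟨i, j, hi, hj, hij⟩ := hs
    obtain ⟨ε, rfl⟩ := exists_add_of_le
      (show Finsupp.single i 1 ≤ δ from Finsupp.single_le_iff.mpr (Nat.one_le_iff_ne_zero.mpr hi))
    have hmul : ∀ (ζ : Mon n) (β : basisMon J), multPoly (φ ∘ c) (ζ + ε, β) =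
        monomial ε 1 * multPoly (φ ∘ c) (ζ, β) := by
      intro ζ β
      simp only [multPoly]
      rw [← mul_assoc, monomial_mul, one_mul, add_comm ε]
    rw [hmul]
    have key : Submodule.span S (multPoly (φ ∘ c) '' {p : Mult J |
        toColex p.1 < toColex (Finsupp.single i 1)}) ≤
        (minSpan (φ ∘ c) Set.univ).comap (LinearMap.mulLeft S (monomial ε 1)) := by
      rw [Submodule.span_le]
      rintro _ ⟨⟨ζ, β⟩, hζ, rfl⟩
      rw [SetLike.mem_coe, Submodule.mem_comap, LinearMap.mulLeft_apply, ← hmul]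
      refine ih (toColex (ζ + ε)) ?_ (ζ + ε) β rfl
      -- The colexicographic order is compatible with multiplication by X^ε.
      exact add_lt_add_left hζ (toColex ε)
    exact key (multPoly_single_mem_span φ hJ hH α hj hij)

end SPolynomials

/-! ### Minors of the coefficient matrices -/

theorem det_mul_eq_zero_of_card_lt {ι κ S : Type*} [Fintype ι] [DecidableEq ι] [Fintype κ]
    [CommRing S] (h : Fintype.card κ < Fintype.card ι) (A : Matrix ι κ S) (B : Matrix κ ι S) :
    (A * B).det = 0 := by
  classical
  let τ := Fin (Fintype.card ι - Fintype.card κ)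
  -- Padding with zero columns and rows makes both factors square; the first then has a zero column.
  have e : κ ⊕ τ ≃ ι := Fintype.equivOfCardEq (by simp [τ]; omega)
  have hprod : A * B = (Matrix.fromCols A (0 : Matrix ι τ S)).submatrix id e.symm *
      (Matrix.fromRows B (0 : Matrix τ ι S)).submatrix e.symm id := by
    rw [Matrix.submatrix_mul_equiv, Matrix.fromCols_mul_fromRows]
    simp
  rw [hprod, Matrix.det_mul, Matrix.det_eq_zero_of_column_eq_zero (e (Sum.inr ⟨0, by omega⟩)),
    zero_mul]
  simp

theorem mem_iff_support_subset (hJ : IsMonomialIdeal J) (f : Poly n k) :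
    f ∈ J ↔ ∀ μ ∈ f.support, μ ∈ monomialsIn J := by
  constructor
  · intro hf μ hμ
    unfold IsMonomialIdeal at hJ
    rw [hJ, mem_ideal_span_monomial_image] at hf
    obtain ⟨ν, hν, hle⟩ := hf μ hμ
    exact monomialsIn_mono hle hν
  · intro h
    rw [f.as_sum]
    refine J.sum_mem fun μ hμ => ?_
    rw [← mul_one (coeff μ f), ← C_mul_monomial]
    exact J.mul_mem_left _ (h μ hμ)

/-- The monomials of `J` of degree `m`. -/
abbrev DegMon (J : Ideal (Poly n k)) (m : ℕ) : Type :=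
  {η : Mon n // η ∈ monomialsIn J ∧ η.degree = m}

instance (m : ℕ) : Finite (DegMon J m) :=
  ((finite_setOf_degree_eq m).subset fun _ h => h.2 :
    {η : Mon n | η ∈ monomialsIn J ∧ η.degree = m}.Finite)

instance (m : ℕ) : Fintype (DegMon J m) := Fintype.ofFinite _

theorem weight_one_eq_degree (μ : Mon n) : Finsupp.weight (1 : Fin (n + 1) → ℕ) μ = μ.degree := by
  rw [Finsupp.degree_eq_weight_one]
  rfl

theorem finrank_degreePart (hJ : IsMonomialIdeal J) (m : ℕ) :
    Module.finrank k (degreePart J m) = Fintype.card (DegMon J m) := by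
  have h : degreePart J m =
      restrictSupport k {η : Mon n | η ∈ monomialsIn J ∧ η.degree = m} := by
    ext f
    rw [degreePart, Submodule.mem_inf, Submodule.restrictScalars_mem, mem_iff_support_subset hJ,
      mem_homogeneousSubmodule, mem_restrictSupport_iff]
    constructor
    · rintro ⟨h1, h2⟩ μ hμ
      exact ⟨h1 μ hμ, by
        rw [← weight_one_eq_degree]; exact h2 (mem_support_iff.mp hμ)⟩
    · intro h
      refine ⟨fun μ hμ => (h hμ).1, fun μ hμ => ?_⟩
      rw [weight_one_eq_degree]
      exact (h (mem_support_iff.mpr hμ)).2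
  rw [h, Module.finrank_eq_nat_card_basis (basisRestrictSupport k _), ← Nat.card_eq_fintype_card]
  rfl

/-- The minimal product with a given head. -/
def starMult (hJ : IsStronglyStable J) {m : ℕ} (η : DegMon J m) : Mult J :=
  (exists_isStar hJ η.2.1).choose

theorem isMin_starMult (hJ : IsStronglyStable J) {m : ℕ} (η : DegMon J m) :
    IsMin (starMult hJ η) :=
  (exists_isStar hJ η.2.1).choose_spec.1.isMin

theorem head_starMult (hJ : IsStronglyStable J) {m : ℕ} (η : DegMon J m) :
    head (starMult hJ η) = η :=
  (exists_isStar hJ η.2.1).choose_spec.2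

section

variable {S : Type u} [CommRing S] (c : Var J → S)

theorem exists_sum_of_mem_minSpan_degree (hJ : IsStronglyStable J) {m : ℕ} {h : Poly n S}
    (hh : h ∈ minSpan c {μ | μ.degree = m}) :
    ∃ a : DegMon J m → S, h = ∑ η, a η • multPoly c (starMult hJ η) := by
  have hset : multPoly c '' {p : Mult J | IsMin p ∧ head p ∈ {μ : Mon n | μ.degree = m}} =
      Set.range fun η : DegMon J m => multPoly c (starMult hJ η) := by
    ext f
    constructor
    · rintro ⟨p, ⟨hp, hd⟩, rfl⟩
      let η : DegMon J m := ⟨head p, head_mem_monomialsIn p, hd⟩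
      exact ⟨η, congrArg _ ((isMin_starMult hJ η).unique hp (head_starMult hJ η))⟩
    · rintro ⟨η, rfl⟩
      exact ⟨_, ⟨isMin_starMult hJ η, by rw [head_starMult]; exact η.2.2⟩, rfl⟩
  rw [minSpan, hset, Submodule.mem_span_range_iff_exists_fun] at hh
  obtain ⟨a, ha⟩ := hh
  exact ⟨a, ha.symm⟩

/-- The coefficients of the minimal products at the monomials of `J`, in degree `m`. -/
def headMatrix (hJ : IsStronglyStable J) (m : ℕ) : Matrix (DegMon J m) (DegMon J m) S :=
  Matrix.of fun η η' => coeff (η' : Mon n) (multPoly c (starMult hJ η))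

/-- Reducing each monomial of J of degree m expresses it, modulo N(J), through minimal products;
these coefficients are the rows of an inverse matrix, over any coefficient ring. -/
theorem isUnit_det_headMatrix {m : ℕ} [DecidableEq (DegMon J m)] (hJ : IsStronglyStable J) :
    IsUnit (headMatrix c hJ m).det := by
  have key : ∀ η : DegMon J m, ∃ a : DegMon J m → S, ∀ η' : DegMon J m,
      ∑ ζ, a ζ * headMatrix c hJ m ζ η' = if η = η' then 1 else 0 := by
    intro η
    obtain ⟨w, hw, hwN⟩ := (reductionClosed_degree (c := c) m).exists_sub_mem_minSpan hJ
      (h := monomial (η : Mon n) (1 : S)) (fun μ hμ => by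
        rw [coeff_monomial] at hμ
        by_cases h : (η : Mon n) = μ
        · rw [← h]; exact η.2.2
        · rw [if_neg h] at hμ; exact absurd rfl hμ)
    obtain ⟨a, ha⟩ := exists_sum_of_mem_minSpan_degree c hJ hw
    refine ⟨a, fun η' => ?_⟩
    have h1 := congrArg (coeff (η' : Mon n)) ha
    have h0 : coeff (η' : Mon n) w = 0 := by
      by_contra h0
      exact (hwN _ h0).2 η'.2.1
    rw [coeff_sub, h0, sub_zero, coeff_sum, coeff_monomial] at h1
    simp only [coeff_smul, smul_eq_mul] at h1
    simp only [headMatrix, Matrix.of_apply, ← h1, Subtype.ext_iff]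
  choose a ha using key
  have h1 : Matrix.of a * headMatrix c hJ m = 1 := by
    ext η η'
    rw [Matrix.mul_apply, Matrix.one_apply]
    exact ha η η'
  exact IsUnit.of_mul_eq_one_right _ (by rw [← Matrix.det_mul, h1, Matrix.det_one])

end

variable {S : Type u} [CommRing S] (φ : CoeffRing J →+* S)

theorem coeff_map_multPoly (p : Mult J) (μ : Mon n) :
    φ (coeff μ (multPoly (generic J) p)) = coeff μ (multPoly (φ ∘ generic J) p) := by
  rw [← map_multPoly, coeff_map]

/-- Under the hypothesis all rows are combinations of the dim J_m minimal ones, so a larger minor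
factors through too small a module. -/
theorem map_minor_eq_zero (hJ : IsStronglyStable J)
    (hV : ∀ p : Mult J, multPoly (φ ∘ generic J) p ∈ minSpan (φ ∘ generic J) Set.univ) {m : ℕ}
    (f : Fin (Module.finrank k (degreePart J m) + 1) → {p : Mult J // (head p).degree = m})
    (g : Fin (Module.finrank k (degreePart J m) + 1) → {δ : Mon n // δ.degree = m}) :
    φ ((coeffMatrix J m).submatrix f g).det = 0 := by
  have key : ∀ i, ∃ a : DegMon J m → S, multPoly (φ ∘ generic J) (f i).1 =
      ∑ η, a η • multPoly (φ ∘ generic J) (starMult hJ η) := by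
    intro i
    have := multPoly_mem_minSpan_degree hJ (hV (f i).1)
    rw [(f i).2] at this
    exact exists_sum_of_mem_minSpan_degree _ hJ this
  choose a ha using key
  have hprod : φ.mapMatrix ((coeffMatrix J m).submatrix f g) =
      (Matrix.of a : Matrix _ (DegMon J m) S) * (Matrix.of fun η j =>
        coeff (g j).1 (multPoly (φ ∘ generic J) (starMult hJ η)) : Matrix (DegMon J m) _ S) := by
    ext i j
    rw [RingHom.mapMatrix_apply, Matrix.map_apply, Matrix.submatrix_apply, coeffMatrix,
      Matrix.of_apply, coeff_map_multPoly, ha, coeff_sum, Matrix.mul_apply]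
    simp
  rw [RingHom.map_det, hprod]
  exact det_mul_eq_zero_of_card_lt (by simp [finrank_degreePart hJ.1]) _ _

/-- Border the invertible head matrix with the row of a non-minimal product and a column γ in N(J):
the minor is a unit times the coefficient at γ of the product's remainder. -/
theorem multPoly_mem_minSpan_of_minors (hJ : IsStronglyStable J) (hA : idealA J ≤ RingHom.ker φ)
    (p : Mult J) : multPoly (φ ∘ generic J) p ∈ minSpan (φ ∘ generic J) Set.univ := by
  classical
  by_cases hp : IsMin p
  · exact multPoly_mem_minSpan hp trivial
  set c := φ ∘ generic J with hc
  obtain ⟨m, hm⟩ : ∃ m, (head p).degree = m := ⟨_, rfl⟩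
  obtain ⟨w, hw, hwN⟩ := (reductionClosed_degree (c := c) m).exists_sub_mem_minSpan hJ
    (fun μ hμ => (degree_of_mem_support_multPoly c hμ).trans hm)
  suffices h0 : w = 0 by
    rw [h0, sub_zero] at hw
    exact minSpan_mono (Set.subset_univ _) hw
  ext γ
  rw [coeff_zero]
  by_contra hγ
  obtain ⟨hγm, hγN⟩ := hwN γ hγ
  obtain ⟨a, ha⟩ := exists_sum_of_mem_minSpan_degree c hJ hw
  let F : DegMon J m ⊕ Unit → {p : Mult J // (head p).degree = m} :=
    Sum.elim (fun η => ⟨starMult hJ η, by rw [head_starMult]; exact η.2.2⟩) fun _ => ⟨p, hm⟩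
  let G : DegMon J m ⊕ Unit → {δ : Mon n // δ.degree = m} :=
    Sum.elim (fun η => ⟨η, η.2.2⟩) fun _ => ⟨γ, hγm⟩
  have hF : Function.Injective F := by
    rintro (η | _) (η' | _) h
    · have h1 : starMult hJ η = starMult hJ η' := congrArg Subtype.val h
      have h2 := congrArg head h1
      rw [head_starMult, head_starMult] at h2
      rw [Subtype.ext h2]
    · have h1 : starMult hJ η = p := congrArg Subtype.val h
      exact absurd (h1 ▸ isMin_starMult hJ η) hp
    · have h1 : p = starMult hJ η' := congrArg Subtype.val h
      exact absurd (h1 ▸ isMin_starMult hJ η') hp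
    · rfl
  have hG : Function.Injective G := by
    rintro (η | _) (η' | _) h
    · have h1 : (η : Mon n) = η' := congrArg (fun δ : {δ : Mon n // δ.degree = m} => δ.1) h
      rw [Subtype.ext h1]
    · have h1 : (η : Mon n) = γ := congrArg (fun δ : {δ : Mon n // δ.degree = m} => δ.1) h
      exact absurd (h1 ▸ η.2.1) hγN
    · have h1 : γ = (η' : Mon n) := congrArg (fun δ : {δ : Mon n // δ.degree = m} => δ.1) h
      exact absurd (h1 ▸ η'.2.1) hγN
    · rfl
  let σ : Fin (Module.finrank k (degreePart J m) + 1) ≃ DegMon J m ⊕ Unit :=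
    Fintype.equivOfCardEq (by simp [finrank_degreePart hJ.1])
  have hdet : φ ((coeffMatrix J m).submatrix (F ∘ σ) (G ∘ σ)).det = 0 :=
    hA (Ideal.subset_span ⟨m, ⟨F ∘ σ, hF.comp σ.injective⟩, ⟨G ∘ σ, hG.comp σ.injective⟩, rfl⟩)
  rw [← Matrix.submatrix_submatrix, Matrix.det_submatrix_equiv_self, RingHom.map_det] at hdet
  let U : Matrix (DegMon J m) Unit S := Matrix.of fun η _ => coeff γ (multPoly c (starMult hJ η))
  -- Row elimination in block form: subtracting the combination `a` of minimal rows from the last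
  -- row leaves only the remainder `w`, which vanishes on the columns from J.
  have hfac : φ.mapMatrix ((coeffMatrix J m).submatrix F G) =
      Matrix.fromBlocks 1 0 (Matrix.of fun (_ : Unit) η => a η) 1 *
        Matrix.fromBlocks (headMatrix c hJ m) U 0 (Matrix.of fun (_ _ : Unit) => coeff γ w) := by
    have hpc : ∀ μ, coeff μ (multPoly c p) =
        coeff μ w + ∑ η, a η * coeff μ (multPoly c (starMult hJ η)) := by
      intro μ
      rw [sub_eq_iff_eq_add'.mp ha, coeff_add, coeff_sum]
      simp
    rw [Matrix.fromBlocks_multiply]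
    ext (η | _) (η' | _)
    · simp [coeffMatrix, coeff_map_multPoly, F, G, headMatrix, hc]
    · simp [coeffMatrix, coeff_map_multPoly, F, G, U, hc]
    · have h0 : coeff (η' : Mon n) w = 0 := by
        by_contra h0
        exact (hwN _ h0).2 η'.2.1
      have := hpc η'
      rw [h0, zero_add] at this
      simp [coeffMatrix, coeff_map_multPoly, F, G, headMatrix, Matrix.mul_apply, ← hc, this]
    · simp [coeffMatrix, coeff_map_multPoly, F, G, U, Matrix.mul_apply, ← hc, hpc γ, add_comm]
  rw [hfac, Matrix.det_mul, Matrix.det_fromBlocks_zero₁₂, Matrix.det_fromBlocks_zero₂₁] at hdet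
  simp only [Matrix.det_one, one_mul, Matrix.det_unique, Matrix.of_apply,
    Matrix.one_apply_eq] at hdet
  exact hγ ((isUnit_det_headMatrix c hJ).mul_right_eq_zero.mp hdet)

theorem idealA_le_ker_iff (hJ : IsStronglyStable J) : idealA J ≤ RingHom.ker φ ↔
    ∀ p : Mult J, multPoly (φ ∘ generic J) p ∈ minSpan (φ ∘ generic J) Set.univ := by
  refine ⟨multPoly_mem_minSpan_of_minors φ hJ, fun h => Ideal.span_le.mpr ?_⟩
  rintro _ ⟨m, f, g, rfl⟩
  exact map_minor_eq_zero φ hJ h f g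

/-! ### Equality of the three ideals -/

theorem idealR'_le_idealR (H : basisMon J → basisMon J → Poly n (CoeffRing J)) :
    idealR' H ≤ idealR H :=
  Ideal.span_mono fun _ ⟨α, α', γ, _, h⟩ => ⟨α, α', γ, h⟩

theorem idealR_le_idealA (hJ : IsStronglyStable J)
    {H : basisMon J → basisMon J → Poly n (CoeffRing J)}
    (hH : ∀ α α', IsCompleteReduction (generic J) (sPoly (generic J) α α') (H α α')) :
    idealR H ≤ idealA J := by
  refine Ideal.span_le.mpr ?_
  rintro _ ⟨α, α', γ, rfl⟩
  have hV := (idealA_le_ker_iff (Ideal.Quotient.mk (idealA J)) hJ).mp (by rw [Ideal.mk_ker])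
  have := congrArg (coeff γ) (map_reduction_eq_zero _ hJ hV (hH α α'))
  rw [coeff_map, coeff_zero] at this
  exact Ideal.Quotient.eq_zero_iff_mem.mp this

theorem idealA_le_idealR' (hJ : IsStronglyStable J)
    {H : basisMon J → basisMon J → Poly n (CoeffRing J)}
    (hH : ∀ α α', IsCompleteReduction (generic J) (sPoly (generic J) α α') (H α α')) :
    idealA J ≤ idealR' H := by
  have h := (idealA_le_ker_iff (Ideal.Quotient.mk (idealR' H)) hJ).mpr
    (multPoly_mem_minSpan_of_reductions _ hJ fun α α' hmin => ⟨H α α', hH α α', ?_⟩)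
  · rwa [Ideal.mk_ker] at h
  · ext γ
    rw [coeff_map, coeff_zero]
    exact Ideal.Quotient.eq_zero_iff_mem.mpr (Ideal.subset_span ⟨α, α', γ, hmin, rfl⟩)

/-! ### Homogeneity of 𝔄 -/

section Grading

attribute [local instance] MvPolynomial.weightedGradedAlgebra

theorem isWeightedHomogeneous_coeff_multPoly (p : Mult J) (μ : Mon n) :
    IsWeightedHomogeneous (lam J) (coeff μ (multPoly (generic J) p))
      (fun i => (head p i : ℤ) - (μ i : ℤ)) := by
  classical
  by_cases h0 : coeff μ (multPoly (generic J) p) = 0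
  · rw [h0]; exact isWeightedHomogeneous_zero _ _ _
  obtain ⟨γ, rfl, hγ⟩ := mem_support_multPoly _ h0
  rw [coeff_multPoly_add]
  rcases mem_support_marked _ hγ with rfl | h
  · rw [coeff_marked_self]
    convert isWeightedHomogeneous_one k (lam J) using 1
    ext i; simp [head]
  · let v : Var J := ⟨(p.2, γ), p.2.2, h⟩
    rw [show coeff γ (marked J (generic J) p.2) = - X v from coeff_marked_var (generic J) v]
    have hw : (fun i => (head p i : ℤ) - ((p.1 + γ) i : ℤ)) = lam J v := by
      ext i; simp [head, lam, v]
    rw [hw]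
    exact (isWeightedHomogeneous_X k (lam J) v).neg

theorem isLamHomogeneous_idealA (J : Ideal (Poly n k)) : IsLamHomogeneous (idealA J) := by
  refine Ideal.homogeneous_span _ _ ?_
  rintro _ ⟨m, f, g, rfl⟩
  refine ⟨∑ i, (fun l => (head (f i).1 l : ℤ)) - ∑ i, fun l => ((g i).1 l : ℤ), ?_⟩
  rw [mem_weightedHomogeneousSubmodule, Matrix.det_apply]
  refine IsWeightedHomogeneous.sum _ _ _ fun τ _ => ?_
  have h := IsWeightedHomogeneous.prod Finset.univ
    (fun i => (coeffMatrix J m).submatrix f g (τ i) i) _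
    fun i _ => isWeightedHomogeneous_coeff_multPoly (f (τ i)).1 (g i).1
  -- All terms of the determinant have the same weight: permuting the rows does not change the sum
  -- of the heads.
  have hw : ∑ i, (fun l => (head (f (τ i)).1 l : ℤ) - ((g i).1 l : ℤ)) =
      ∑ i, (fun l => (head (f i).1 l : ℤ)) - ∑ i, fun l => ((g i).1 l : ℤ) := by
    rw [← Equiv.sum_comp τ fun i => (fun l => (head (f i).1 l : ℤ)), ← Finset.sum_sub_distrib]
    rfl
  rw [hw] at h
  rcases Int.units_eq_one_or (Equiv.Perm.sign τ) with hs | hs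
  · rw [hs, one_smul]; exact h
  · rw [hs, Units.neg_smul, one_smul]; exact h.neg

end Grading

/-! ### Ideals with basis N(J) and marked sets -/

section Family

theorem exists_finsupp_of_support_subset {w : Poly n k}
    (hw : ∀ μ, coeff μ w ≠ 0 → μ ∈ sousEscalier J) : ∃ l : sousEscalier J →₀ k,
      Finsupp.linearCombination k
        (fun γ : sousEscalier J => monomial (γ : Mon n) (1 : k)) l = w := by
  have h : w ∈ restrictSupport k (sousEscalier J) := fun μ hμ => hw μ (mem_support_iff.mp hμ)
  rw [restrictSupport_eq_span, Set.image_eq_range] at h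
  exact Finsupp.mem_span_range_iff_exists_finsupp.mp h

theorem coeff_linearCombination_monomial (l : sousEscalier J →₀ k) (μ : Mon n) :
    coeff μ (Finsupp.linearCombination k
      (fun γ : sousEscalier J => monomial (γ : Mon n) (1 : k)) l) =
      l.sum fun γ a => if (γ : Mon n) = μ then a else 0 := by
  classical
  rw [Finsupp.linearCombination_apply, Finsupp.sum, coeff_sum, Finsupp.sum]
  refine Finset.sum_congr rfl fun γ _ => ?_
  rw [coeff_smul, coeff_monomial, smul_eq_mul, mul_ite, mul_one, mul_zero]

theorem linearCombination_mk (I : Ideal (Poly n k)) (l : sousEscalier J →₀ k) :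
    Finsupp.linearCombination k
      (fun γ : sousEscalier J => Ideal.Quotient.mk I (monomial (γ : Mon n) (1 : k))) l =
    Ideal.Quotient.mk I (Finsupp.linearCombination k
      (fun γ : sousEscalier J => monomial (γ : Mon n) (1 : k)) l) :=
  (Finsupp.apply_linearCombination k (Ideal.Quotient.mkₐ k I).toLinearMap _ l).symm

/-- The monomials of the sous-escalier are independent modulo `I` exactly when no nonzero element
of `I` is a combination of them. -/
theorem linearIndependent_mk_iff (I : Ideal (Poly n k)) :
    LinearIndependent k
      (fun γ : sousEscalier J => Ideal.Quotient.mk I (monomial (γ : Mon n) (1 : k))) ↔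
    ∀ w ∈ I, (∀ μ, coeff μ w ≠ 0 → μ ∈ sousEscalier J) → w = 0 := by
  classical
  rw [linearIndependent_iff]
  constructor
  · intro h w hw hN
    obtain ⟨l, rfl⟩ := exists_finsupp_of_support_subset hN
    rw [h l (by rw [linearCombination_mk, Ideal.Quotient.eq_zero_iff_mem.mpr hw]), map_zero]
  · intro h l hl
    rw [linearCombination_mk, Ideal.Quotient.eq_zero_iff_mem] at hl
    have h0 := h _ hl fun μ hμ => by
      rw [coeff_linearCombination_monomial] at hμ
      obtain ⟨γ, -, hγ⟩ := Finset.exists_ne_zero_of_sum_ne_zero hμ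
      have : (γ : Mon n) = μ := by by_contra h; simp [h] at hγ
      rw [← this]; exact γ.2
    ext γ
    have h1 := coeff_linearCombination_monomial l γ
    rw [h0, coeff_zero, Finsupp.sum, Finset.sum_eq_single γ] at h1
    · simpa using h1.symm
    · intro γ' _ hne
      rw [if_neg (fun h => hne (Subtype.ext h))]
    · intro h
      simpa using h

/-- The monomials of the sous-escalier span the quotient by `I` exactly when every polynomial is
congruent to a combination of them. -/
theorem span_mk_eq_top_iff (I : Ideal (Poly n k)) :
    Submodule.span k (Set.range
      (fun γ : sousEscalier J => Ideal.Quotient.mk I (monomial (γ : Mon n) (1 : k)))) = ⊤ ↔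
    ∀ h : Poly n k, ∃ w, h - w ∈ I ∧ ∀ μ, coeff μ w ≠ 0 → μ ∈ sousEscalier J := by
  classical
  constructor
  · intro ht h
    have hm : Ideal.Quotient.mk I h ∈ Submodule.span k (Set.range
      (fun γ : sousEscalier J => Ideal.Quotient.mk I (monomial (γ : Mon n) (1 : k)))) := by
      rw [ht]; trivial
    obtain ⟨l, hl⟩ := (Finsupp.mem_span_range_iff_exists_finsupp).mp hm
    rw [← Finsupp.linearCombination_apply, linearCombination_mk] at hl
    refine ⟨_, Ideal.Quotient.eq.mp hl.symm, fun μ hμ => ?_⟩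
    rw [coeff_linearCombination_monomial] at hμ
    obtain ⟨γ, -, hγ⟩ := Finset.exists_ne_zero_of_sum_ne_zero hμ
    have : (γ : Mon n) = μ := by by_contra h; simp [h] at hγ
    rw [← this]; exact γ.2
  · intro hN
    rw [eq_top_iff]
    rintro x -
    obtain ⟨h, rfl⟩ := Ideal.Quotient.mk_surjective x
    obtain ⟨w, hw, hwN⟩ := hN h
    obtain ⟨l, rfl⟩ := exists_finsupp_of_support_subset hwN
    rw [Ideal.Quotient.eq.mpr hw, ← linearCombination_mk]
    exact Finsupp.mem_span_range_iff_exists_finsupp.mpr ⟨l, rfl⟩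

variable {c : Var J → k}

theorem multPoly_mem_span_marked (p : Mult J) :
    multPoly c p ∈ Ideal.span (Set.range (marked J c)) :=
  Ideal.mul_mem_left _ _ (Ideal.subset_span ⟨p.2, rfl⟩)

theorem minSpan_le {I : Ideal (Poly n k)} (hI : ∀ p, multPoly c p ∈ I) (P : Set (Mon n)) :
    minSpan c P ≤ I.restrictScalars k := by
  refine Submodule.span_le.mpr ?_
  rintro _ ⟨p, -, rfl⟩
  exact hI p

/-- The hypothesis says precisely that the span of the minimal products absorbs all products, hence
is the ideal itself. -/
theorem mem_span_marked_iff
    (hV : ∀ p : Mult J, multPoly c p ∈ minSpan c Set.univ) {h : Poly n k} :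
    h ∈ Ideal.span (Set.range (marked J c)) ↔ h ∈ minSpan c Set.univ := by
  refine ⟨fun hh => ?_, fun hh => minSpan_le multPoly_mem_span_marked _ hh⟩
  obtain ⟨g, rfl⟩ := Finsupp.mem_ideal_span_range_iff_exists_finsupp.mp hh
  refine Submodule.sum_mem _ fun α _ => ?_
  change g α * marked J c α ∈ _
  rw [(g α).as_sum, Finset.sum_mul]
  refine Submodule.sum_mem _ fun δ _ => ?_
  rw [← mul_one (coeff δ (g α)), ← C_mul_monomial, mul_assoc, C_mul']
  exact Submodule.smul_mem _ _ (hV (δ, α))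

attribute [local instance] MvPolynomial.gradedAlgebra

theorem marked_isHomogeneous (c : Var J → k) (α : basisMon J) :
    (marked J c α).IsHomogeneous (α : Mon n).degree := by
  intro μ hμ
  rw [weight_one_eq_degree]
  rcases mem_support_marked c hμ with rfl | h
  · rfl
  · exact h.2

theorem span_marked_mem_family (hJ : IsStronglyStable J)
    (hV : ∀ p : Mult J, multPoly c p ∈ minSpan c Set.univ) :
    Ideal.span (Set.range (marked J c)) ∈ family J := by
  refine ⟨Ideal.homogeneous_span _ _ ?_, (linearIndependent_mk_iff _).mpr ?_,
    (span_mk_eq_top_iff _).mpr ?_⟩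
  · rintro _ ⟨α, rfl⟩
    exact ⟨_, marked_isHomogeneous c α⟩
  · intro w hw hN
    exact eq_zero_of_mem_minSpan hJ ((mem_span_marked_iff hV).mp hw) hN
  · intro h
    obtain ⟨w, hw, hwN⟩ := (reductionClosed_univ (c := c)).exists_sub_mem_minSpan hJ
      (h := h) fun _ _ => trivial
    exact ⟨w, (mem_span_marked_iff hV).mpr hw, fun μ hμ => (hwN μ hμ).2⟩

theorem coeff_marked_sub_marked_mem {c c' : Var J → k} {α : basisMon J} {μ : Mon n}
    (hμ : coeff μ (marked J c α - marked J c' α) ≠ 0) : μ ∈ sousEscalier J := by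
  by_contra hN
  refine hμ ?_
  rw [coeff_sub, coeff_marked, coeff_marked, dif_neg (fun h => hN h.1), dif_neg (fun h => hN h.1),
    sub_self]

/-- Two marked polynomials with the same head differ by an element of I supported on N(J), which is
zero. -/
theorem eq_of_span_marked_eq {I : Ideal (Poly n k)} (hI : I ∈ family J) {c c' : Var J → k}
    (h : Ideal.span (Set.range (marked J c)) = I) (h' : Ideal.span (Set.range (marked J c')) = I) :
    c = c' := by
  ext v
  let α : basisMon J := ⟨v.1.1, v.2.1⟩
  have h1 : marked J c α ∈ I := by rw [← h]; exact Ideal.subset_span ⟨α, rfl⟩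
  have h1' : marked J c' α ∈ I := by rw [← h']; exact Ideal.subset_span ⟨α, rfl⟩
  have h2 := (linearIndependent_mk_iff I).mp hI.2.1 _ (sub_mem h1 h1')
    fun _ => coeff_marked_sub_marked_mem
  have h3 := congrArg (coeff v.1.2) h2
  rw [coeff_sub, coeff_marked_var, coeff_marked_var, coeff_zero] at h3
  exact neg_injective (sub_eq_zero.mp h3)

theorem homogeneousComponent_mem {I : Ideal (Poly n k)}
    (hI : I.IsHomogeneous (homogeneousSubmodule (Fin (n + 1)) k)) {f : Poly n k} (hf : f ∈ I)
    (m : ℕ) : homogeneousComponent m f ∈ I := by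
  have h : (DirectSum.decompose (homogeneousSubmodule (Fin (n + 1)) k) f m : Poly n k) =
      homogeneousComponent m f := decomposition.decompose'_apply f m
  rw [← h]
  exact hI m hf

theorem exists_marked_of_mem_family (hJ : IsStronglyStable J) {I : Ideal (Poly n k)}
    (hI : I ∈ family J) : ∃ c : Var J → k,
      (∀ p : Mult J, multPoly c p ∈ minSpan c Set.univ) ∧
        Ideal.span (Set.range (marked J c)) = I := by
  classical
  obtain ⟨hhom, hli, hsp⟩ := hI
  rw [linearIndependent_mk_iff] at hli
  rw [span_mk_eq_top_iff] at hsp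
  choose w hw hwN using fun α : basisMon J => hsp (monomial (α : Mon n) 1)
  -- The normal form of X^α modulo I need not be homogeneous; only its coefficients in degree |α|
  -- are kept, and homogeneity of I justifies this.
  let c : Var J → k := fun v => coeff v.1.2 (w ⟨v.1.1, v.2.1⟩)
  have hmem : ∀ α, marked J c α ∈ I := by
    intro α
    have h1 := homogeneousComponent_mem hhom (hw α) (α : Mon n).degree
    convert h1
    ext μ
    rw [coeff_marked, coeff_homogeneousComponent, coeff_sub, coeff_monomial]
    by_cases hd : μ.degree = (α : Mon n).degree
    · rw [if_pos hd]
      congr 1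
      · simp [eq_comm]
      · by_cases hμ : μ ∈ sousEscalier J
        · rw [dif_pos ⟨hμ, hd⟩]
        · rw [dif_neg (fun h => hμ h.1)]
          by_contra h0
          exact hμ (hwN α μ (Ne.symm h0))
    · rw [if_neg hd, dif_neg (fun h => hd h.2), if_neg (fun h => hd (by rw [h])), sub_zero]
  have hle : Ideal.span (Set.range (marked J c)) ≤ I :=
    Ideal.span_le.mpr (by rintro _ ⟨α, rfl⟩; exact hmem α)
  have hmin : ∀ h ∈ I, h ∈ minSpan c Set.univ := by
    intro h hh
    obtain ⟨v, hv, hvN⟩ := (reductionClosed_univ (c := c)).exists_sub_mem_minSpan hJ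
      (h := h) fun _ _ => trivial
    -- The remainder of an element of I is in I and supported on N(J), so independence kills it;
    -- this gives both V and equality of the ideals.
    have hvI : v ∈ I := by
      have := sub_mem hh (minSpan_le (fun p => hle (multPoly_mem_span_marked p)) _ hv)
      rwa [sub_sub_cancel] at this
    rwa [hli v hvI fun μ hμ => (hvN μ hμ).2, sub_zero] at hv
  refine ⟨c, fun p => hmin _ (hle (multPoly_mem_span_marked p)), le_antisymm hle fun h hh => ?_⟩
  exact minSpan_le multPoly_mem_span_marked _ (hmin h hh)

theorem marked_zero (α : basisMon J) :
    marked J (0 : Var J → k) α = monomial (α : Mon n) 1 := by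
  classical
  ext μ
  have h0 : (if h : μ ∈ sousEscalier J ∧ μ.degree = (α : Mon n).degree then
      (0 : Var J → k) ⟨(α, μ), α.2, h⟩ else 0) = 0 := by
    split_ifs <;> rfl
  rw [coeff_marked, h0, sub_zero, coeff_monomial]
  simp [eq_comm]

theorem multPoly_zero (p : Mult J) : multPoly (0 : Var J → k) p = monomial (head p) 1 := by
  rw [multPoly, marked_zero, monomial_mul, one_mul, head]

theorem multPoly_zero_mem_minSpan (hJ : IsStronglyStable J) (p : Mult J) :
    multPoly (0 : Var J → k) p ∈ minSpan (0 : Var J → k) Set.univ := by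
  obtain ⟨q, hq, hqp⟩ := exists_isStar hJ (head_mem_monomialsIn p)
  rw [multPoly_zero, ← hqp, ← multPoly_zero]
  exact multPoly_mem_minSpan hq.isMin trivial

theorem span_marked_zero (hJ : IsMonomialIdeal J) :
    Ideal.span (Set.range (marked J (0 : Var J → k))) = J := by
  refine le_antisymm (Ideal.span_le.mpr ?_) ?_
  · rintro _ ⟨α, rfl⟩
    rw [marked_zero]
    exact α.2.1
  · conv_lhs => rw [hJ]
    refine Ideal.span_le.mpr ?_
    rintro _ ⟨μ, hμ, rfl⟩
    obtain ⟨α, hα, hle⟩ := exists_basisMon_le hμ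
    obtain ⟨δ, rfl⟩ := exists_add_of_le hle
    have := multPoly_mem_span_marked (c := 0) ((δ, ⟨α, hα⟩) : Mult J)
    rw [multPoly_zero, head] at this
    change monomial (α + δ) 1 ∈ _
    rwa [add_comm α]

end Family

/-! ### Closed points of the stratum -/

section Points

theorem idealA_le_coordIdeal_iff (hJ : IsStronglyStable J) (c : Var J → k) :
    idealA J ≤ coordIdeal c ↔ ∀ p : Mult J, multPoly c p ∈ minSpan c Set.univ := by
  have h : (eval c : CoeffRing J → k) ∘ generic J = c := by
    ext v
    simp [generic]
  have := idealA_le_ker_iff (eval c) hJ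
  rwa [h] at this

/-- Points of affine space on the stratum correspond to the ideals of the family. -/
def pointsEquivFamily (hJ : IsStronglyStable J) :
    {c : Var J → k // idealA J ≤ coordIdeal c} ≃ family J :=
  Equiv.ofBijective (fun c => ⟨Ideal.span (Set.range (marked J c.1)),
    span_marked_mem_family hJ ((idealA_le_coordIdeal_iff hJ c.1).mp c.2)⟩) <| by
    constructor
    · intro c c' h
      exact Subtype.ext (eq_of_span_marked_eq (span_marked_mem_family hJ
        ((idealA_le_coordIdeal_iff hJ c.1).mp c.2)) rfl (congrArg Subtype.val h).symm)
    · rintro ⟨I, hI⟩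
      obtain ⟨c, hc, h⟩ := exists_marked_of_mem_family hJ hI
      exact ⟨⟨c, (idealA_le_coordIdeal_iff hJ c).mpr hc⟩, Subtype.ext h⟩

theorem pointsEquivFamily_apply (hJ : IsStronglyStable J)
    (c : {c : Var J → k // idealA J ≤ coordIdeal c}) :
    (pointsEquivFamily hJ c : Ideal (Poly n k)) = Ideal.span (Set.range (marked J c.1)) := rfl

theorem coordIdeal_injective : Function.Injective (coordIdeal (J := J)) := by
  intro c c' h
  ext v
  have h1 : X v - C (c v) ∈ coordIdeal c := by simp [coordIdeal, RingHom.mem_ker]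
  rw [h, coordIdeal, RingHom.mem_ker] at h1
  simp only [map_sub, eval_X, eval_C, sub_eq_zero] at h1
  exact h1.symm

theorem pointIdeal_eq_comap (x : BSt J) : pointIdeal x =
    Ideal.comap (Ideal.Quotient.mk (idealA J))
      (PrimeSpectrum.asIdeal (R := CoeffRing J ⧸ idealA J) x) := rfl

theorem isClosed_singleton_iff (x : BSt J) : IsClosed ({x} : Set (BSt J)) ↔
    (PrimeSpectrum.asIdeal (R := CoeffRing J ⧸ idealA J) x).IsMaximal :=
  PrimeSpectrum.isClosed_singleton_iff_isMaximal (R := CoeffRing J ⧸ idealA J) x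

theorem pointIdeal_injective : Function.Injective (pointIdeal (J := J)) := by
  intro x y h
  exact PrimeSpectrum.ext (Ideal.comap_injective_of_surjective _ Ideal.Quotient.mk_surjective h)

theorem exists_point (c : Var J → k) (hc : idealA J ≤ coordIdeal c) :
    ∃ x : BSt J, IsClosed ({x} : Set (BSt J)) ∧ pointIdeal x = coordIdeal c := by
  let ψ : CoeffRing J ⧸ idealA J →+* k := Ideal.Quotient.lift (idealA J) (eval c) hc
  have hψ : Function.Surjective ψ := fun a =>
    ⟨Ideal.Quotient.mk _ (C a), (Ideal.Quotient.lift_mk _ _ _).trans (eval_C a)⟩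
  have hmax : (RingHom.ker ψ).IsMaximal := RingHom.ker_isMaximal_of_surjective ψ hψ
  let x : PrimeSpectrum (CoeffRing J ⧸ idealA J) := ⟨RingHom.ker ψ, hmax.isPrime⟩
  refine ⟨x, (isClosed_singleton_iff x).mpr hmax, ?_⟩
  change Ideal.comap (Ideal.Quotient.mk (idealA J)) (RingHom.ker ψ) = RingHom.ker (eval c)
  rw [RingHom.comap_ker]
  exact congrArg RingHom.ker (Ideal.Quotient.lift_comp_mk _ _ _)

/-- The Nullstellensatz: the pullback to k[C] of the maximal ideal of a closed point is the ideal of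
a point of k^N, which contains 𝔄. -/
theorem exists_coordIdeal_eq [IsAlgClosed k] (x : BSt J) (hx : IsClosed ({x} : Set (BSt J))) :
    ∃ c : Var J → k, pointIdeal x = coordIdeal c ∧ idealA J ≤ coordIdeal c := by
  have hmax := (isClosed_singleton_iff x).mp hx
  have hm : (pointIdeal x).IsMaximal := by
    rw [pointIdeal_eq_comap]
    exact Ideal.comap_isMaximal_of_surjective _ Ideal.Quotient.mk_surjective
  obtain ⟨c, hc⟩ := (isMaximal_iff_eq_vanishingIdeal_singleton (K := k)).mp hm
  have h : pointIdeal x = coordIdeal c := by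
    rw [hc]
    ext f
    rw [mem_vanishingIdeal_singleton_iff, coordIdeal, RingHom.mem_ker, aeval_eq_eval]
  refine ⟨c, h, ?_⟩
  rw [← h, pointIdeal_eq_comap]
  intro f hf
  rw [Ideal.mem_comap, Ideal.Quotient.eq_zero_iff_mem.mpr hf]
  exact zero_mem _

/-- The closed points of the stratum are the points of `k^N` at which the ideal of the stratum
vanishes. -/
def pointsEquivClosedPoints [IsAlgClosed k] (J : Ideal (Poly n k)) :
    {c : Var J → k // idealA J ≤ coordIdeal c} ≃ {x : BSt J // IsClosed ({x} : Set (BSt J))} :=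
  Equiv.ofBijective (fun c => ⟨(exists_point c.1 c.2).choose,
    (exists_point c.1 c.2).choose_spec.1⟩) <| by
    constructor
    · intro c c' h
      refine Subtype.ext (coordIdeal_injective ?_)
      rw [← (exists_point c.1 c.2).choose_spec.2, ← (exists_point c'.1 c'.2).choose_spec.2]
      exact congrArg (fun x => pointIdeal x.1) h
    · rintro ⟨x, hx⟩
      obtain ⟨c, h, hc⟩ := exists_coordIdeal_eq x hx
      refine ⟨⟨c, hc⟩, Subtype.ext (pointIdeal_injective ?_)⟩
      rw [h]
      exact (exists_point c hc).choose_spec.2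

theorem pointIdeal_pointsEquivClosedPoints [IsAlgClosed k]
    (c : {c : Var J → k // idealA J ≤ coordIdeal c}) :
    pointIdeal (pointsEquivClosedPoints J c).1 = coordIdeal c.1 :=
  (exists_point c.1 c.2).choose_spec.2

end Points

end Stratum

end

theorem theorem22 {k : Type*} [Field k] [IsAlgClosed k] (n : ℕ)
    (J : Ideal (Stratum.Poly n k)) (hJ : Stratum.IsStronglyStable J) :
    -- closed points of the stratum correspond bijectively to the ideals of the family
    (∃ e : {x : Stratum.BSt J // IsClosed ({x} : Set (Stratum.BSt J))} ≃ Stratum.family J,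
      (∀ x, ∃ c : Stratum.Var J → k,
        Stratum.pointIdeal x.1 = Stratum.coordIdeal c ∧
        (e x : Ideal (Stratum.Poly n k)) = Ideal.span (Set.range (Stratum.marked J c))) ∧
      ∃ o, Stratum.pointIdeal o.1 = Stratum.coordIdeal (0 : Stratum.Var J → k) ∧
        (e o : Ideal (Stratum.Poly n k)) = J) ∧
    -- the ideal of the stratum is homogeneous for the grading over `ℤ^{n+1}`
    Stratum.IsLamHomogeneous (Stratum.idealA J) ∧
    -- complete reductions of the S-polynomials exist, and any choice of them gives the same ideal
    (∀ α α' : Stratum.basisMon J, ∃ h, Stratum.IsCompleteReduction (Stratum.generic J)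
      (Stratum.sPoly (Stratum.generic J) α α') h) ∧
    (∀ H : Stratum.basisMon J → Stratum.basisMon J → Stratum.Poly n (Stratum.CoeffRing J),
      (∀ α α', Stratum.IsCompleteReduction (Stratum.generic J)
        (Stratum.sPoly (Stratum.generic J) α α') (H α α')) →
      Stratum.idealA J = Stratum.idealR H ∧ Stratum.idealR H = Stratum.idealR' H) := by
  refine ⟨⟨(Stratum.pointsEquivClosedPoints J).symm.trans (Stratum.pointsEquivFamily hJ), ?_, ?_⟩,
    Stratum.isLamHomogeneous_idealA J,
    fun α α' => Stratum.exists_isCompleteReduction _ hJ _, fun H hH => ?_⟩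
  · intro x
    obtain ⟨c, rfl⟩ := (Stratum.pointsEquivClosedPoints J).surjective x
    refine ⟨c.1, Stratum.pointIdeal_pointsEquivClosedPoints c, ?_⟩
    rw [Equiv.trans_apply, Equiv.symm_apply_apply, Stratum.pointsEquivFamily_apply]
  · let o : {c : Stratum.Var J → k // Stratum.idealA J ≤ Stratum.coordIdeal c} :=
      ⟨0, (Stratum.idealA_le_coordIdeal_iff hJ 0).mpr (Stratum.multPoly_zero_mem_minSpan hJ)⟩
    refine ⟨Stratum.pointsEquivClosedPoints J o, Stratum.pointIdeal_pointsEquivClosedPoints o, ?_⟩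
    rw [Equiv.trans_apply, Equiv.symm_apply_apply, Stratum.pointsEquivFamily_apply,
      Stratum.span_marked_zero hJ.1]
  · have h₁ := Stratum.idealR'_le_idealR H
    have h₂ := Stratum.idealR_le_idealA hJ hH
    have h₃ := Stratum.idealA_le_idealR' hJ hH
    exact ⟨le_antisymm (h₃.trans h₁) h₂, le_antisymm (h₂.trans h₃) h₁⟩
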